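/- For a formal power series $F=\sum_{n\ge 0}\sum_{m\in\mathbb Z} c(m,n)\,z^m q^n$ in $q$ whose coefficients (of each $q^n$) are Laurent polynomials in $z$ with integer coefficients, write $F\succeq 0$ if $c(m,n)\ge 0$ for all $m\in\mathbb Z$ and $n\ge 0$. Let $$E(q)=\prod_{n=1}^\infty(1-q^n),\qquad (a;q)_\infty=\prod_{n=0}^\infty(1-aq^{n}),\qquad [a;q]_\infty=(a;q)_\infty\,(a^{-1}q;q)_\infty .$$ Then $$\frac{E(q^2)\,[z^4;q^2]_\infty}{[z^2;q^2]_\infty\,[qz^3;q^2]_\infty}\succeq 0 \qquad\text{and}\qquad \frac{E(q^3)\,(z^2;q^3)_\infty}{(q^3z^{-1};q^3)_\infty\,(z;q)_\infty}\succeq 0 .$$ Here each quotient denotes the unique element $F$ of $\mathbb Z[z,z^{-1}][[q]]$ whose product with the denominator is the numerator; the existence and uniqueness of $F$ are part of the claim. -/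

import Mathlib

open scoped LaurentPolynomial PowerSeries

noncomputable section

namespace QProducts

/-- Formal power series in `q` whose coefficients are integer Laurent polynomials in `z`:
the variable `q` is `PowerSeries.X` and `z ^ i` is `LaurentPolynomial.T i`. -/
abbrev Series : Type := PowerSeries (LaurentPolynomial ℤ)

/-- The variable `q`. -/
def q : Series := PowerSeries.X

/-- The integer power `z ^ i` of the variable `z`. -/
def zpow (i : ℤ) : Series := PowerSeries.C (LaurentPolynomial.T i)

/-- The finite product `(a;p)_N = ∏_{k=0}^{N-1} (1 - a p^k)`. -/
def qPoch (a p : Series) (N : ℕ) : Series :=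
  ∏ k ∈ Finset.range N, (1 - a * p ^ k)

/-- The infinite product `(a;p)_∞ = ∏_{k≥0} (1 - a p^k)`, for `p` without constant term in `q`.
The factors with `k > n` are congruent to `1` modulo `q^(n+1)`, so the coefficient of `q^n` is
that of any partial product with at least `n + 1` factors; see `coeff_qPoch_eq`. -/
def qPochInf (a p : Series) : Series :=
  PowerSeries.mk fun n => PowerSeries.coeff n (qPoch a p (n + 1))

/-- `(a;p)_∞` is the coefficientwise limit of the finite products `(a;p)_N`. -/
theorem coeff_qPoch_eq (a p : Series) (hp : PowerSeries.constantCoeff p = 0) (n N : ℕ)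
    (hN : n + 1 ≤ N) :
    PowerSeries.coeff n (qPoch a p N) = PowerSeries.coeff n (qPochInf a p) := by
  rw [qPochInf, PowerSeries.coeff_mk]
  induction N, hN using Nat.le_induction with
  | base => rfl
  | succ M hM ih =>
    rw [← ih, qPoch, Finset.prod_range_succ, ← qPoch, mul_sub, mul_one, map_sub, sub_eq_self]
    have hX : (PowerSeries.X : Series) ^ M ∣ qPoch a p M * (a * p ^ M) :=
      ((pow_dvd_pow_of_dvd (PowerSeries.X_dvd_iff.mpr hp) M).mul_left a).mul_left _
    exact PowerSeries.X_pow_dvd_iff.mp hX n (by omega)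

/-- `E(p) = ∏_{n≥1} (1 - p^n)`. -/
def E (p : Series) : Series := qPochInf p p

/-- The bracket `[z^i q^j; q^s]_∞ = (z^i q^j; q^s)_∞ (z^(-i) q^(s-j); q^s)_∞`, where `j ≤ s`
and `s ≥ 1`. -/
def bracket (i : ℤ) (j s : ℕ) : Series :=
  qPochInf (zpow i * q ^ j) (q ^ s) * qPochInf (zpow (-i) * q ^ (s - j)) (q ^ s)

/-- The first arguments of the two products in `bracket i j s` multiply to the base `q ^ s`, so
the second one is `x⁻¹ q ^ s` if the first one is `x`. -/
theorem bracket_args (i : ℤ) (j s : ℕ) (h : j ≤ s) :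
    (zpow i * q ^ j) * (zpow (-i) * q ^ (s - j)) = q ^ s := by
  have hz : zpow i * zpow (-i) = 1 := by
    rw [zpow, zpow, ← map_mul, ← LaurentPolynomial.T_add, add_neg_cancel,
      LaurentPolynomial.T_zero, map_one]
  calc _ = (zpow i * zpow (-i)) * (q ^ j * q ^ (s - j)) := by ring
    _ = q ^ s := by rw [hz, one_mul, ← pow_add, Nat.add_sub_cancel' h]

/-- `F ⪰ 0`: every coefficient of `z^m q^n` in `F` is nonnegative. -/
def Nonneg (F : Series) : Prop :=
  ∀ (n : ℕ) (m : ℤ), 0 ≤ (PowerSeries.coeff n F : LaurentPolynomial ℤ).coeff m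

/-- `num / den ⪰ 0`: there is exactly one series `F` with `F * den = num`, and all its
coefficients are nonnegative. -/
def QuotientNonneg (num den : Series) : Prop :=
  (∃! F : Series, F * den = num) ∧ ∀ F : Series, F * den = num → Nonneg F

end QProducts

end

namespace QProducts

open Filter Topology
open scoped PowerSeries.WithPiTopology

/-- The discrete topology on the coefficient ring. -/
scoped instance coeffTopology : TopologicalSpace (LaurentPolynomial ℤ) := ⊥

scoped instance coeffDiscreteTopology : DiscreteTopology (LaurentPolynomial ℤ) := ⟨rfl⟩

theorem tendsto_qPoch (a : Series) {p : Series} (hp : PowerSeries.constantCoeff p = 0) :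
    Tendsto (qPoch a p) atTop (𝓝 (qPochInf a p)) := by
  rw [PowerSeries.WithPiTopology.tendsto_iff_coeff_tendsto]
  intro n
  exact tendsto_atTop_of_eventually_const (i₀ := n + 1) fun N hN => coeff_qPoch_eq a p hp n N hN

theorem qPoch_succ (a p : Series) (N : ℕ) :
    qPoch a p (N + 1) = qPoch a p N * (1 - a * p ^ N) := by
  rw [qPoch, Finset.prod_range_succ, qPoch]

theorem qPoch_add (a p : Series) (M N : ℕ) :
    qPoch a p (M + N) = qPoch a p M * qPoch (a * p ^ M) p N := by
  simp only [qPoch, Finset.prod_range_add, mul_assoc, pow_add]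

theorem qPochInf_eq_qPoch_mul (a : Series) {p : Series} (hp : PowerSeries.constantCoeff p = 0)
    (N : ℕ) : qPochInf a p = qPoch a p N * qPochInf (a * p ^ N) p := by
  have h1 : Tendsto (fun M => qPoch a p (N + M)) atTop (𝓝 (qPochInf a p)) :=
    (tendsto_qPoch a hp).comp (tendsto_atTop_mono (fun M => Nat.le_add_left M N) tendsto_id)
  have h2 := (tendsto_qPoch (a * p ^ N) hp).const_mul (qPoch a p N)
  exact tendsto_nhds_unique h1 (by simpa only [qPoch_add] using h2)

theorem qPochInf_eq_one_sub_mul (a : Series) {p : Series}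
    (hp : PowerSeries.constantCoeff p = 0) :
    qPochInf a p = (1 - a) * qPochInf (a * p) p := by
  simpa [qPoch] using qPochInf_eq_qPoch_mul a hp 1

theorem qPoch_mul (a p : Series) (m N : ℕ) :
    qPoch a p (m * N) = ∏ r ∈ Finset.range m, qPoch (a * p ^ r) (p ^ m) N := by
  induction N with
  | zero => simp [qPoch]
  | succ N ih =>
    rw [mul_add, mul_one, qPoch_add, ih, qPoch, ← Finset.prod_mul_distrib]
    refine Finset.prod_congr rfl fun r _ => ?_
    rw [qPoch_succ]
    ring

/-- The factors of `(a;p)_∞` sorted by the residue of their index modulo `m`. -/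
theorem qPochInf_eq_prod (a : Series) {p : Series} (hp : PowerSeries.constantCoeff p = 0)
    {m : ℕ} (hm : 0 < m) :
    qPochInf a p = ∏ r ∈ Finset.range m, qPochInf (a * p ^ r) (p ^ m) := by
  have hpm : PowerSeries.constantCoeff (p ^ m) = 0 := by simp [hp, hm.ne']
  have h1 : Tendsto (fun N => qPoch a p (m * N)) atTop (𝓝 (qPochInf a p)) :=
    (tendsto_qPoch a hp).comp (tendsto_id.const_mul_atTop' hm)
  have h2 := tendsto_finsetProd (Finset.range m) fun r _ => tendsto_qPoch (a * p ^ r) hpm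
  exact tendsto_nhds_unique h1 (by simpa only [qPoch_mul] using h2)

theorem qPochInf_sq (a : Series) {p : Series} (hp : PowerSeries.constantCoeff p = 0) :
    qPochInf (a ^ 2) (p ^ 2) = qPochInf a p * qPochInf (-a) p := by
  have h1 := tendsto_qPoch (a ^ 2) (p := p ^ 2) (by simp [hp])
  have h2 := (tendsto_qPoch a hp).mul (tendsto_qPoch (-a) hp)
  refine tendsto_nhds_unique h1 (h2.congr fun N => ?_)
  simp only [qPoch, ← Finset.prod_mul_distrib]
  exact Finset.prod_congr rfl fun k _ => by ring

theorem qPochInf_zero {p : Series} (hp : PowerSeries.constantCoeff p = 0) : qPochInf 0 p = 1 :=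
  tendsto_nhds_unique (tendsto_qPoch 0 hp) (tendsto_const_nhds.congr fun N => by simp [qPoch])

theorem constantCoeff_qPoch (a : Series) {p : Series} (hp : PowerSeries.constantCoeff p = 0)
    (N : ℕ) : PowerSeries.constantCoeff (qPoch a p (N + 1)) = 1 - PowerSeries.constantCoeff a := by
  simp [qPoch, Finset.prod_range_succ', hp]

theorem constantCoeff_qPochInf (a : Series) {p : Series}
    (hp : PowerSeries.constantCoeff p = 0) :
    PowerSeries.constantCoeff (qPochInf a p) = 1 - PowerSeries.constantCoeff a := by
  rw [← constantCoeff_qPoch a hp 0, ← PowerSeries.coeff_zero_eq_constantCoeff_apply,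
    ← PowerSeries.coeff_zero_eq_constantCoeff_apply, coeff_qPoch_eq a p hp 0 1 le_rfl]

theorem qPochInf_ne_zero {a p : Series} (hp : PowerSeries.constantCoeff p = 0)
    (ha : PowerSeries.constantCoeff a ≠ 1) : qPochInf a p ≠ 0 := by
  intro h
  have := constantCoeff_qPochInf a hp
  rw [h, map_zero] at this
  exact ha (sub_eq_zero.mp this.symm).symm

theorem E_ne_zero {p : Series} (hp : PowerSeries.constantCoeff p = 0) : E p ≠ 0 :=
  qPochInf_ne_zero hp (by simp [hp])

theorem zpow_zero : zpow 0 = 1 := by simp [zpow]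

theorem zpow_mul_zpow (i j : ℤ) : zpow i * zpow j = zpow (i + j) := by
  rw [zpow, zpow, zpow, ← map_mul, LaurentPolynomial.T_add]

theorem zpow_pow (i : ℤ) (n : ℕ) : zpow i ^ n = zpow (n * i) := by
  rw [zpow, zpow, ← map_pow, LaurentPolynomial.T_pow]

theorem constantCoeff_q_pow {n : ℕ} (hn : n ≠ 0) : PowerSeries.constantCoeff (q ^ n) = 0 := by
  simp [q, hn]

/-! ### Nonnegativity -/

theorem Nonneg.add {F G : Series} (hF : Nonneg F) (hG : Nonneg G) : Nonneg (F + G) :=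
  fun n m => by simpa using add_nonneg (hF n m) (hG n m)

theorem Nonneg.mul {F G : Series} (hF : Nonneg F) (hG : Nonneg G) : Nonneg (F * G) := by
  intro n m
  rw [PowerSeries.coeff_mul, AddMonoidAlgebra.coeff_sum, Finsupp.finsetSum_apply]
  refine Finset.sum_nonneg fun x _ => ?_
  rw [AddMonoidAlgebra.coeff_mul]
  refine Finset.sum_nonneg fun i _ => Finset.sum_nonneg fun j _ => ?_
  dsimp only
  split_ifs
  · exact mul_nonneg (hF _ _) (hG _ _)
  · exact le_rfl

theorem nonneg_zpow (i : ℤ) : Nonneg (zpow i) := by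
  intro n m
  rw [zpow, PowerSeries.coeff_C]
  split_ifs
  · rw [LaurentPolynomial.T_apply]; split_ifs <;> simp
  · simp

theorem nonneg_one : Nonneg 1 := zpow_zero ▸ nonneg_zpow 0

theorem nonneg_q : Nonneg q := by
  intro n m
  rw [q, PowerSeries.coeff_X]
  split_ifs
  · simpa using nonneg_one 0 m
  · simp

theorem Nonneg.pow {F : Series} (hF : Nonneg F) (n : ℕ) : Nonneg (F ^ n) := by
  induction n with
  | zero => simpa using nonneg_one
  | succ n ih => rw [pow_succ]; exact ih.mul hF

theorem nonneg_zpow_mul_q_pow (i : ℤ) (n : ℕ) : Nonneg (zpow i * q ^ n) :=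
  (nonneg_zpow i).mul (nonneg_q.pow n)

theorem Nonneg.hasSum {ι : Type*} {f : ι → Series} {F : Series} (hF : HasSum f F)
    (hf : ∀ i, Nonneg (f i)) : Nonneg F := by
  intro n m
  have h := (PowerSeries.WithPiTopology.hasSum_iff_hasSum_coeff _).mp hF n
  rw [HasSum, nhds_discrete, tendsto_pure] at h
  obtain ⟨s, hs⟩ := h.exists
  rw [← hs, AddMonoidAlgebra.coeff_sum, Finsupp.finsetSum_apply]
  exact Finset.sum_nonneg fun i _ => hf i n m

theorem summable_of_X_pow_dvd {ι : Type*} {f : ι → Series} (e : ι → ℕ)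
    (he : ∀ N, {i | e i ≤ N}.Finite) (h : ∀ i, PowerSeries.X ^ e i ∣ f i) : Summable f := by
  rw [PowerSeries.WithPiTopology.summable_iff_summable_coeff]
  intro n
  refine summable_of_hasFiniteSupport ((he n).subset fun i hi => ?_)
  by_contra hn
  exact hi (PowerSeries.X_pow_dvd_iff.mp (h i) n (not_le.mp hn))

theorem X_pow_dvd_of_hasSum {ι : Type*} {f : ι → Series} {F : Series} (hF : HasSum f F) {N : ℕ}
    (h : ∀ i, PowerSeries.X ^ N ∣ f i) : PowerSeries.X ^ N ∣ F := by
  rw [PowerSeries.X_pow_dvd_iff]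
  intro n hn
  refine ((PowerSeries.WithPiTopology.hasSum_iff_hasSum_coeff _).mp hF n).unique ?_
  simp only [fun i => PowerSeries.X_pow_dvd_iff.mp (h i) n hn, hasSum_zero]

theorem tendsto_of_X_pow_dvd_sub {F : ℕ → Series} {G : Series}
    (h : ∀ N, PowerSeries.X ^ N ∣ F N - G) : Tendsto F atTop (𝓝 G) := by
  rw [PowerSeries.WithPiTopology.tendsto_iff_coeff_tendsto]
  intro n
  refine tendsto_atTop_of_eventually_const (i₀ := n + 1) fun N hN => ?_
  rw [← sub_eq_zero, ← map_sub]
  exact PowerSeries.X_pow_dvd_iff.mp (h N) n hN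

theorem X_pow_dvd_pow {p : Series} (hp : PowerSeries.constantCoeff p = 0) (n : ℕ) :
    PowerSeries.X ^ n ∣ p ^ n :=
  pow_dvd_pow_of_dvd (PowerSeries.X_dvd_iff.mpr hp) n

/-- The reciprocal of `(p;p)_n`. -/
noncomputable def invPoch (p : Series) (n : ℕ) : Series :=
  ∏ k ∈ Finset.range n, PowerSeries.invOfUnit (1 - p ^ (k + 1)) 1

theorem one_sub_mul_invOfUnit {p : Series} (hp : PowerSeries.constantCoeff p = 0) :
    (1 - p) * PowerSeries.invOfUnit (1 - p) 1 = 1 :=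
  PowerSeries.mul_invOfUnit _ _ (by simp [hp])

theorem invPoch_succ_mul {p : Series} (hp : PowerSeries.constantCoeff p = 0) (n : ℕ) :
    invPoch p (n + 1) * (1 - p ^ (n + 1)) = invPoch p n := by
  rw [invPoch, Finset.prod_range_succ, mul_assoc, mul_comm _ (1 - p ^ (n + 1)),
    one_sub_mul_invOfUnit (by simp [hp]), mul_one, invPoch]

theorem nonneg_invOfUnit {p : Series} (hp : PowerSeries.constantCoeff p = 0) (hp' : Nonneg p) :
    Nonneg (PowerSeries.invOfUnit (1 - p) 1) := by
  have h := PowerSeries.WithPiTopology.tsum_pow_mul_one_sub_of_constantCoeff_eq_zero hp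
  have h' : PowerSeries.invOfUnit (1 - p) 1 = ∑' i : ℕ, p ^ i :=
    (left_inv_eq_right_inv h (one_sub_mul_invOfUnit hp)).symm
  rw [h']
  exact Nonneg.hasSum
    (PowerSeries.WithPiTopology.summable_pow_of_constantCoeff_eq_zero hp).hasSum hp'.pow

theorem nonneg_invPoch {p : Series} (hp : PowerSeries.constantCoeff p = 0) (hp' : Nonneg p)
    (n : ℕ) : Nonneg (invPoch p n) := by
  induction n with
  | zero => simpa [invPoch] using nonneg_one
  | succ n ih =>
    rw [invPoch, Finset.prod_range_succ]
    exact ih.mul (nonneg_invOfUnit (by simp [hp]) (hp'.pow _))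

theorem nonneg_one_sub_mul_invPoch {p : Series} (hp : PowerSeries.constantCoeff p = 0)
    (hp' : Nonneg p) (n : ℕ) : Nonneg ((1 - p) * invPoch p (n + 1)) := by
  rw [invPoch, Finset.prod_range_succ', zero_add, pow_one, mul_comm _ (PowerSeries.invOfUnit _ _),
    ← mul_assoc, one_sub_mul_invOfUnit hp, one_mul]
  induction n with
  | zero => simpa using nonneg_one
  | succ n ih =>
    rw [Finset.prod_range_succ]
    exact ih.mul (nonneg_invOfUnit (by simp [hp]) (hp'.pow _))

/-- The basic hypergeometric series `∑ (a;p)_n / (p;p)_n b^n`. -/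
noncomputable def qBinomialSeries (a b p : Series) : Series :=
  ∑' n, qPoch a p n * invPoch p n * b ^ n

theorem hasSum_qBinomialSeries (a p : Series) {b : Series}
    (hb : PowerSeries.constantCoeff b = 0) :
    HasSum (fun n => qPoch a p n * invPoch p n * b ^ n) (qBinomialSeries a b p) :=
  (summable_of_X_pow_dvd id Set.finite_Iic fun n => (X_pow_dvd_pow hb n).mul_left _).hasSum

theorem one_sub_mul_qBinomialSeries (a : Series) {b p : Series}
    (hp : PowerSeries.constantCoeff p = 0) (hb : PowerSeries.constantCoeff b = 0) :
    (1 - b) * qBinomialSeries a b p = (1 - a * b) * qBinomialSeries a (b * p) p := by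
  have h1 := hasSum_qBinomialSeries a p hb
  have h2 := hasSum_qBinomialSeries a p (b := b * p) (by simp [hb])
  have h3 := (hasSum_nat_add_iff' 1).mpr (h1.sub h2)
  have h4 := (h1.mul_left b).sub (h2.mul_left (a * b))
  have h5 := h3.unique (h4.congr_fun ?_)
  · simp only [Finset.range_one, Finset.sum_singleton, pow_zero, sub_self, sub_zero] at h5
    linear_combination h5
  intro n
  have hs := invPoch_succ_mul hp n
  rw [← hs, qPoch_succ]
  ring

theorem X_pow_dvd_qBinomialSeries_sub_one (a p : Series) {b : Series} {N : ℕ} (hN : N ≠ 0)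
    (hb : PowerSeries.X ^ N ∣ b) : PowerSeries.X ^ N ∣ qBinomialSeries a b p - 1 := by
  have h := (hasSum_nat_add_iff' 1).mpr (hasSum_qBinomialSeries a p (b := b)
    (PowerSeries.X_dvd_iff.mp ((dvd_pow_self _ hN).trans hb)))
  simp only [Finset.range_one, Finset.sum_singleton, pow_zero, qPoch, invPoch,
    Finset.range_zero, Finset.prod_empty, mul_one] at h
  exact X_pow_dvd_of_hasSum h fun n => ((hb.mul_right _).mul_left _ : _ ∣ _ * (b * b ^ n)).trans
    (by rw [pow_succ'])

/-- The `q`-binomial theorem. -/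
theorem qPochInf_mul_qBinomialSeries (a : Series) {b p : Series}
    (hp : PowerSeries.constantCoeff p = 0) (hb : PowerSeries.constantCoeff b = 0) :
    qPochInf b p * qBinomialSeries a b p = qPochInf (a * b) p := by
  have key : ∀ N, qPoch b p N * qBinomialSeries a b p =
      qPoch (a * b) p N * qBinomialSeries a (b * p ^ N) p := by
    intro N
    induction N with
    | zero => simp [qPoch]
    | succ N ih =>
      have h := one_sub_mul_qBinomialSeries a hp (b := b * p ^ N) (by simp [hb])
      rw [qPoch_succ, mul_right_comm, ih, qPoch_succ, pow_succ, ← mul_assoc b]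
      linear_combination (qPoch (a * b) p N) * h
  have h1 := (tendsto_qPoch b hp).mul_const (qBinomialSeries a b p)
  have h2 : Tendsto (fun N => qBinomialSeries a (b * p ^ N) p) atTop (𝓝 1) := by
    refine tendsto_of_X_pow_dvd_sub fun N => ?_
    rcases eq_or_ne N 0 with rfl | hN
    · simp
    · exact X_pow_dvd_qBinomialSeries_sub_one a p hN ((X_pow_dvd_pow hp N).mul_left b)
  have h3 := (tendsto_qPoch (a * b) hp).mul h2
  rw [mul_one] at h3
  exact tendsto_nhds_unique h1 (by simpa only [key] using h3)

/-- The reciprocal of `(b;p)_∞`, as given by Euler's expansion. -/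
noncomputable def invPochInf (b p : Series) : Series := qBinomialSeries 0 b p

theorem qPochInf_mul_invPochInf {b p : Series} (hp : PowerSeries.constantCoeff p = 0)
    (hb : PowerSeries.constantCoeff b = 0) : qPochInf b p * invPochInf b p = 1 := by
  rw [invPochInf, qPochInf_mul_qBinomialSeries 0 hp hb, zero_mul, qPochInf_zero hp]

theorem hasSum_invPochInf (p : Series) {b : Series} (hb : PowerSeries.constantCoeff b = 0) :
    HasSum (fun n => invPoch p n * b ^ n) (invPochInf b p) := by
  simpa [qPoch, invPochInf] using hasSum_qBinomialSeries 0 p hb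

theorem nonneg_invPochInf_sub_one {b p : Series} (hp : PowerSeries.constantCoeff p = 0)
    (hb : PowerSeries.constantCoeff b = 0) (hp' : Nonneg p) (hb' : Nonneg b) :
    Nonneg (invPochInf b p - 1) := by
  have h := (hasSum_nat_add_iff' 1).mpr (hasSum_invPochInf p hb)
  simp only [Finset.range_one, Finset.sum_singleton, pow_zero, invPoch, Finset.range_zero,
    Finset.prod_empty, mul_one] at h
  exact Nonneg.hasSum h fun n => (nonneg_invPoch hp hp' _).mul (hb'.pow _)

theorem nonneg_invPochInf {b p : Series} (hp : PowerSeries.constantCoeff p = 0)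
    (hb : PowerSeries.constantCoeff b = 0) (hp' : Nonneg p) (hb' : Nonneg b) :
    Nonneg (invPochInf b p) := by
  simpa using (nonneg_invPochInf_sub_one hp hb hp' hb').add nonneg_one

theorem nonneg_one_sub_mul_invPochInf_sub {b p : Series} (hp : PowerSeries.constantCoeff p = 0)
    (hb : PowerSeries.constantCoeff b = 0) (hp' : Nonneg p) (hb' : Nonneg b) :
    Nonneg ((1 - p) * invPochInf b p - (1 - p + b)) := by
  have h := (hasSum_nat_add_iff' 2).mpr ((hasSum_invPochInf p hb).mul_left (1 - p))
  have h1 : (1 - p) * invPoch p 1 = 1 := by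
    simpa [invPoch] using one_sub_mul_invOfUnit hp
  have h0 : invPoch p 0 = 1 := by simp [invPoch]
  have h2 : ∑ i ∈ Finset.range 2, (1 - p) * (invPoch p i * b ^ i) = 1 - p + b := by
    rw [Finset.sum_range_succ, Finset.sum_range_one, h0]
    linear_combination b * h1
  rw [h2] at h
  refine Nonneg.hasSum h fun n => ?_
  rw [← mul_assoc]
  exact (nonneg_one_sub_mul_invPoch hp hp' _).mul (hb'.pow _)

theorem invPochInf_mul_qPoch {a p : Series} (hp : PowerSeries.constantCoeff p = 0)
    (ha : PowerSeries.constantCoeff a = 0) (n : ℕ) :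
    invPochInf a p * qPoch a p n = invPochInf (a * p ^ n) p := by
  have h1 := qPochInf_mul_invPochInf hp ha
  have h2 := qPochInf_mul_invPochInf hp (b := a * p ^ n) (by simp [ha])
  rw [qPochInf_eq_qPoch_mul a hp n] at h1
  linear_combination invPochInf (a * p ^ n) p * h1 - invPochInf a p * qPoch a p n * h2

theorem hasSum_qBinomialSeries_mul_invPochInf {a b p : Series}
    (hp : PowerSeries.constantCoeff p = 0) (ha : PowerSeries.constantCoeff a = 0)
    (hb : PowerSeries.constantCoeff b = 0) :
    HasSum (fun n => invPoch p n * b ^ n * invPochInf (a * p ^ n) p)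
      (qBinomialSeries a b p * invPochInf a p) := by
  refine ((hasSum_qBinomialSeries a p hb).mul_right (invPochInf a p)).congr_fun fun n => ?_
  rw [← invPochInf_mul_qPoch hp ha]
  ring

/-- `(ab;p)_∞ / ((a;p)_∞ (b;p)_∞) ⪰ 0`. -/
theorem exists_nonneg_mul_eq_qPochInf_mul {a b p : Series}
    (hp : PowerSeries.constantCoeff p = 0) (ha : PowerSeries.constantCoeff a = 0)
    (hb : PowerSeries.constantCoeff b = 0) (hp' : Nonneg p) (ha' : Nonneg a) (hb' : Nonneg b) :
    ∃ G, Nonneg G ∧ G * (qPochInf a p * qPochInf b p) = qPochInf (a * b) p := by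
  refine ⟨_, Nonneg.hasSum (hasSum_qBinomialSeries_mul_invPochInf hp ha hb) fun n =>
    ((nonneg_invPoch hp hp' n).mul (hb'.pow n)).mul
      (nonneg_invPochInf hp (by simp [ha]) hp' (ha'.mul (hp'.pow n))), ?_⟩
  rw [← qPochInf_mul_qBinomialSeries a hp hb]
  linear_combination qPochInf b p * qBinomialSeries a b p * qPochInf_mul_invPochInf hp ha

/-- `(1 + c) (p;p)_∞ / ((cp;p)_∞ (p/c;p)_∞) ⪰ 0`. -/
theorem exists_nonneg_mul_eq_one_add_mul_E {b c p : Series}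
    (hp : PowerSeries.constantCoeff p = 0) (hb : PowerSeries.constantCoeff b = 0)
    (hp' : Nonneg p) (hb' : Nonneg b) (hc' : Nonneg c) (hbc : b * c = p) :
    ∃ K, Nonneg K ∧ K * (qPochInf (c * p) p * qPochInf b p) = (1 + c) * E p := by
  have ha : PowerSeries.constantCoeff (c * p) = 0 := by simp [hp]
  have ha' := hc'.mul hp'
  have hS := (hasSum_qBinomialSeries_mul_invPochInf hp ha hb).mul_left (1 - p)
  set S := (1 - p) * (qBinomialSeries (c * p) b p * invPochInf (c * p) p) with hSdef
  have hT := (hasSum_nat_add_iff' 2).mpr hS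
  have hT' := Nonneg.hasSum hT fun n => by
    rw [← mul_assoc, ← mul_assoc]
    exact ((nonneg_one_sub_mul_invPoch hp hp' _).mul (hb'.pow _)).mul
      (nonneg_invPochInf hp (by simp [hp]) hp' (ha'.mul (hp'.pow _)))
  have hI : (1 - p) * invPoch p 1 = 1 := by
    simpa [invPoch] using one_sub_mul_invOfUnit hp
  have hI0 : invPoch p 0 = 1 := by simp [invPoch]
  have h0 := nonneg_one_sub_mul_invPochInf_sub hp ha hp' ha'
  have h1 := hb'.mul (nonneg_invPochInf_sub_one hp (b := c * p * p) (by simp [hp]) hp'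
    (ha'.mul hp'))
  refine ⟨(1 + c) * S, ?_, ?_⟩
  · have h2 : Nonneg (1 + b + c + c * c * p) :=
      ((nonneg_one.add hb').add hc').add ((hc'.mul hc').mul hp')
    have h3 := ((nonneg_one.add hc').mul ((hT'.add h0).add h1)).add h2
    convert h3 using 1
    rw [Finset.sum_range_succ, Finset.sum_range_one, hI0]
    simp only [pow_zero, pow_one, one_mul, mul_one]
    linear_combination (1 + c) * b * invPochInf (c * p * p) p * hI + hbc
  · have h4 := qPochInf_mul_qBinomialSeries (c * p) hp hb
    have h5 := qPochInf_mul_invPochInf hp ha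
    have h6 : E p = (1 - p) * qPochInf (c * p * b) p := by
      rw [E, qPochInf_eq_one_sub_mul p hp]
      congr 2
      linear_combination - p * hbc
    rw [hSdef, h6, ← h4]
    linear_combination (1 + c) * (1 - p) * qPochInf b p * qBinomialSeries (c * p) b p * h5

/-- The Gaussian binomial coefficient in the base `p`. -/
noncomputable def gaussBinom (p : Series) : ℕ → ℕ → Series
  | _, 0 => 1
  | 0, _ + 1 => 0
  | n + 1, k + 1 => gaussBinom p n k + p ^ (k + 1) * gaussBinom p n (k + 1)

theorem gaussBinom_zero_right (p : Series) (n : ℕ) : gaussBinom p n 0 = 1 := by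
  cases n <;> rfl

theorem gaussBinom_succ_succ (p : Series) (n k : ℕ) : gaussBinom p (n + 1) (k + 1) =
    gaussBinom p n k + p ^ (k + 1) * gaussBinom p n (k + 1) := rfl

theorem gaussBinom_eq_zero (p : Series) {n k : ℕ} (h : n < k) : gaussBinom p n k = 0 := by
  induction n generalizing k with
  | zero => obtain ⟨k, rfl⟩ := Nat.exists_eq_add_of_lt h; rfl
  | succ n ih =>
    obtain ⟨k, rfl⟩ := Nat.exists_eq_succ_of_ne_zero (by omega : k ≠ 0)
    rw [Nat.succ_eq_add_one, gaussBinom_succ_succ, ih (by omega), ih (by omega)]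
    ring

theorem gaussBinom_mul_qPoch (p : Series) {n k l : ℕ} (h : k + l = n) :
    gaussBinom p n k * (qPoch p p k * qPoch p p l) = qPoch p p n := by
  induction n generalizing k l with
  | zero =>
    obtain ⟨rfl, rfl⟩ : k = 0 ∧ l = 0 := by omega
    simp [qPoch, gaussBinom_zero_right]
  | succ n ih =>
    rcases k with _ | k
    · obtain rfl : l = n + 1 := by omega
      simp [qPoch, gaussBinom_zero_right]
    rw [gaussBinom_succ_succ]
    rcases l with _ | l
    · obtain rfl : k = n := by omega
      have h1 := ih (k := k) (l := 0) (by omega)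
      rw [gaussBinom_eq_zero p (Nat.lt_succ_self k), qPoch_succ p p k]
      linear_combination (1 - p * p ^ k) * h1
    · have h1 := ih (k := k) (l := l + 1) (by omega)
      have h2 := ih (k := k + 1) (l := l) (by omega)
      obtain rfl : n = k + l + 1 := by omega
      rw [qPoch_succ p p (k + l + 1)]
      rw [qPoch_succ p p l] at h1 ⊢
      rw [qPoch_succ p p k] at h2 ⊢
      linear_combination (1 - p * p ^ k) * h1 + p ^ (k + 1) * (1 - p * p ^ l) * h2

theorem choose_add_two (m n : ℕ) :
    (m + n).choose 2 = m.choose 2 + n.choose 2 + m * n := by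
  induction n with
  | zero => simp
  | succ n ih =>
    rw [← add_assoc, Nat.choose_succ_succ' (m + n), Nat.choose_succ_succ' n, ih]
    simp only [Nat.choose_one_right]
    ring

theorem choose_succ_two (n : ℕ) : (n + 1).choose 2 = n.choose 2 + n := by
  simpa using choose_add_two n 1

theorem mul_self_eq_choose_two (m : ℕ) : m * m = m.choose 2 + m.choose 2 + m := by
  induction m with
  | zero => rfl
  | succ m ih =>
    rw [choose_succ_two]
    linear_combination ih

/-- The finite `q`-binomial theorem, in homogeneous form. -/
theorem prod_sub_mul_pow_eq_sum (a y p : Series) (M : ℕ) :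
    ∏ i ∈ Finset.range M, (y - a * p ^ i) = ∑ x ∈ Finset.HasAntidiagonal.antidiagonal M,
      (-1) ^ x.1 * p ^ x.1.choose 2 * gaussBinom p M x.1 * a ^ x.1 * y ^ x.2 := by
  induction M generalizing a with
  | zero => simp [gaussBinom_zero_right]
  | succ M ih =>
    have h : ∏ i ∈ Finset.range M, (y - a * p ^ (i + 1)) =
        ∏ i ∈ Finset.range M, (y - a * p * p ^ i) :=
      Finset.prod_congr rfl fun i _ => by ring
    rw [Finset.prod_range_succ', h, ih, Finset.Nat.sum_antidiagonal_succ]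
    let t : ℕ × ℕ → Series := fun x =>
      (-1) ^ x.1 * p ^ (x.1 + 1).choose 2 * gaussBinom p M x.1 * a ^ x.1 * y ^ x.2
    have ht : ∑ x ∈ Finset.HasAntidiagonal.antidiagonal M, t (x.1, x.2 + 1) =
        y ^ (M + 1) + ∑ x ∈ Finset.HasAntidiagonal.antidiagonal M, t (x.1 + 1, x.2) := by
      have h1 := Finset.Nat.sum_antidiagonal_succ (n := M) (f := t)
      rw [Finset.Nat.sum_antidiagonal_succ'] at h1
      have h2 : t (M + 1, 0) = 0 := by simp [t, gaussBinom_eq_zero p (Nat.lt_succ_self M)]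
      have h3 : t (0, M + 1) = y ^ (M + 1) := by simp [t, gaussBinom_zero_right]
      rwa [h2, h3, zero_add] at h1
    have h4 : ∀ x : ℕ × ℕ, (-1) ^ x.1 * p ^ x.1.choose 2 * gaussBinom p M x.1 * (a * p) ^ x.1 *
        y ^ x.2 * y = t (x.1, x.2 + 1) := fun x => by
      simp only [t, choose_succ_two]; ring
    rw [pow_zero, mul_one, mul_sub, Finset.sum_mul, Finset.sum_congr rfl fun x _ => h4 x, ht,
      Finset.sum_mul, add_sub_assoc, ← Finset.sum_sub_distrib]
    congr 1
    · simp [gaussBinom_zero_right]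
    · refine Finset.sum_congr rfl fun x _ => ?_
      simp only [t, gaussBinom_succ_succ, choose_succ_two]
      ring

/-- The `k`-th term `(-1)^k p^(k(k-1)/2) a^k` of the Jacobi theta series, where `a⁻¹ = b p⁻¹`. -/
noncomputable def thetaTerm (a b p : Series) (k : ℤ) : Series :=
  (-1) ^ k.natAbs * p ^ k.natAbs.choose 2 * (if 0 ≤ k then a else b) ^ k.natAbs

theorem pow_mul_thetaTerm {a b p : Series} (hab : a * b = p) {N i j : ℕ} (h : i + j = 2 * N) :
    (-1) ^ i * p ^ i.choose 2 * a ^ i * (p ^ N) ^ j =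
      (-a) ^ N * p ^ (N.choose 2 + N * N) * thetaTerm a b p (i - N) := by
  rcases le_or_gt N i with hi | hi
  · obtain ⟨k, rfl⟩ := Nat.exists_eq_add_of_le hi
    obtain rfl : N = j + k := by omega
    have h1 : (((j + k + k : ℕ) : ℤ) - (j + k : ℕ)) = k := by push_cast; ring
    rw [h1, thetaTerm, if_pos (by positivity), Int.natAbs_natCast, choose_add_two (j + k) k,
      neg_pow a]
    ring
  · obtain ⟨m, rfl⟩ := Nat.exists_eq_add_of_le hi.le
    obtain rfl : j = i + 2 * m := by omega
    have h1 : ((i : ℤ) - (i + m : ℕ)) = -m := by push_cast; ring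
    have h2 : p ^ m = a ^ m * b ^ m := by rw [← mul_pow, hab]
    have h3 := mul_self_eq_choose_two m
    have h4 : (p ^ (i + m)) ^ (i + 2 * m) =
        p ^ (i * m + m.choose 2 + m.choose 2 + (i + m) * (i + m)) * p ^ m := by
      rw [← pow_mul, ← pow_add]
      congr 1
      linear_combination h3
    rw [h1, thetaTerm, if_neg (by omega), Int.natAbs_neg, Int.natAbs_natCast, choose_add_two i m,
      neg_pow a, h4, h2, pow_add (-1) i m]
    have h5 : ((-1 : Series) ^ m) * (-1) ^ m = 1 := by rw [← mul_pow]; simp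
    linear_combination -((-1) ^ i * p ^ i.choose 2 * a ^ i *
      p ^ (i * m + m.choose 2 + m.choose 2 + (i + m) * (i + m)) * a ^ m * b ^ m) * h5

theorem prod_pow_sub_mul_pow {a b p : Series} (hab : a * b = p) (N : ℕ) :
    ∏ i ∈ Finset.range (2 * N), (p ^ N - a * p ^ i) =
      (-a) ^ N * p ^ (N.choose 2 + N * N) * (qPoch a p N * qPoch b p N) := by
  have h1 : ∏ i ∈ Finset.range N, (p ^ N - a * p ^ i) =
      (-a) ^ N * p ^ N.choose 2 * qPoch b p N := by
    have h2 : ∀ n, ∏ i ∈ Finset.range n, p ^ i = p ^ n.choose 2 := fun n => by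
      induction n with
      | zero => simp
      | succ n ih => rw [Finset.prod_range_succ, ih, choose_succ_two, pow_add]
    have h3 : (-a) ^ N = ∏ i ∈ Finset.range N, (-a) := by simp
    rw [qPoch, ← Finset.prod_range_reflect (fun k => 1 - b * p ^ k) N, ← h2, h3,
      ← Finset.prod_mul_distrib, ← Finset.prod_mul_distrib]
    refine Finset.prod_congr rfl fun i hi => ?_
    rw [Finset.mem_range] at hi
    have h4 : p ^ N = a * b * (p ^ i * p ^ (N - 1 - i)) := by
      rw [hab, ← pow_add, ← pow_succ']
      congr 1
      omega
    rw [h4]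
    ring
  have h5 : ∏ i ∈ Finset.range N, (p ^ N - a * p ^ (N + i)) = p ^ (N * N) * qPoch a p N := by
    have h6 : p ^ (N * N) = ∏ i ∈ Finset.range N, p ^ N := by simp [pow_mul]
    rw [qPoch, h6, ← Finset.prod_mul_distrib]
    exact Finset.prod_congr rfl fun i _ => by ring
  rw [two_mul, Finset.prod_range_add, h1, h5]
  ring

/-- The finite form of the Jacobi triple product. -/
theorem qPoch_mul_qPoch_eq_sum {a b p : Series} (hab : a * b = p) (hp : p ≠ 0) (N : ℕ) :
    qPoch a p N * qPoch b p N = ∑ k ∈ Finset.Icc (-N : ℤ) N,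
      gaussBinom p (2 * N) (k + N).toNat * thetaTerm a b p k := by
  have ha : a ≠ 0 := by rintro rfl; exact hp (by rw [← hab, zero_mul])
  have h0 : (-a) ^ N * p ^ (N.choose 2 + N * N) ≠ 0 :=
    mul_ne_zero (pow_ne_zero _ (neg_ne_zero.mpr ha)) (pow_ne_zero _ hp)
  apply mul_left_cancel₀ h0
  rw [← prod_pow_sub_mul_pow hab, prod_sub_mul_pow_eq_sum, Finset.mul_sum]
  refine Finset.sum_nbij' (fun x => (x.1 : ℤ) - N)
    (fun k => ((k + N).toNat, (N - k).toNat)) ?_ ?_ ?_ ?_ ?_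
  · intro x hx
    rw [Finset.HasAntidiagonal.mem_antidiagonal] at hx
    rw [Finset.mem_Icc]
    omega
  · intro k hk
    rw [Finset.mem_Icc] at hk
    rw [Finset.HasAntidiagonal.mem_antidiagonal]
    omega
  · intro x hx
    rw [Finset.HasAntidiagonal.mem_antidiagonal] at hx
    ext <;> dsimp only <;> omega
  · intro k hk
    rw [Finset.mem_Icc] at hk
    dsimp only
    omega
  · intro x hx
    rw [Finset.HasAntidiagonal.mem_antidiagonal] at hx
    rw [sub_add_cancel, Int.toNat_natCast]
    linear_combination gaussBinom p (2 * N) x.1 * pow_mul_thetaTerm hab hx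

theorem X_pow_dvd_qPoch_sub {p : Series} (hp : PowerSeries.constantCoeff p = 0) {m n : ℕ}
    (h : m ≤ n) : PowerSeries.X ^ (m + 1) ∣ qPoch p p n - qPoch p p m := by
  induction n, h using Nat.le_induction with
  | base => simp
  | succ n hn ih =>
    rw [qPoch_succ, mul_one_sub, sub_right_comm]
    refine dvd_sub ih (Dvd.dvd.mul_left ?_ _)
    rw [← pow_succ']
    exact (pow_dvd_pow _ (by omega)).trans (X_pow_dvd_pow hp (n + 1))

theorem X_pow_dvd_qPoch_mul_gaussBinom_sub_one {p : Series}
    (hp : PowerSeries.constantCoeff p = 0) {N m k l : ℕ} (hN : m ≤ N) (hk : m ≤ k) (hl : m ≤ l)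
    (h : k + l = 2 * N) :
    PowerSeries.X ^ (m + 1) ∣ qPoch p p N * gaussBinom p (2 * N) k - 1 := by
  have hU : qPoch p p m * invPoch p m = 1 := by
    rw [qPoch, invPoch, ← Finset.prod_mul_distrib]
    refine Finset.prod_eq_one fun k _ => ?_
    rw [← pow_succ']
    exact one_sub_mul_invOfUnit (by simp [hp])
  obtain ⟨cN, hcN⟩ := X_pow_dvd_qPoch_sub hp hN
  obtain ⟨ck, hck⟩ := X_pow_dvd_qPoch_sub hp hk
  obtain ⟨cl, hcl⟩ := X_pow_dvd_qPoch_sub hp hl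
  obtain ⟨c, hc⟩ := X_pow_dvd_qPoch_sub hp (by omega : m ≤ 2 * N)
  have hg := gaussBinom_mul_qPoch p h
  rw [eq_add_of_sub_eq hc, eq_add_of_sub_eq hck, eq_add_of_sub_eq hcl] at hg
  rw [eq_add_of_sub_eq hcN]
  set x : Series := PowerSeries.X ^ (m + 1)
  set g := gaussBinom p (2 * N) k
  set U := qPoch p p m
  set V := invPoch p m
  have h1 : g * U - 1 = x * (V * (c - g * (ck * U + U * cl + x * ck * cl))) := by
    linear_combination V * hg + (1 - g * U) * hU
  exact ⟨V * (c - g * (ck * U + U * cl + x * ck * cl)) + cN * g, by linear_combination h1⟩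

theorem X_pow_dvd_thetaTerm (a b : Series) {p : Series} (hp : PowerSeries.constantCoeff p = 0)
    (k : ℤ) : PowerSeries.X ^ k.natAbs.choose 2 ∣ thetaTerm a b p k :=
  ((X_pow_dvd_pow hp _).mul_left _).mul_right _

theorem le_choose_two_add_one (n : ℕ) : n ≤ n.choose 2 + 1 := by
  induction n with
  | zero => simp
  | succ n ih => rw [choose_succ_two]; rcases n with _ | n <;> omega

/-- The Jacobi triple product identity. -/
theorem hasSum_thetaTerm {a b p : Series} (hab : a * b = p) (hp : p ≠ 0)
    (hp0 : PowerSeries.constantCoeff p = 0) :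
    HasSum (thetaTerm a b p) (E p * (qPochInf a p * qPochInf b p)) := by
  have hs : Summable (thetaTerm a b p) := by
    refine summable_of_X_pow_dvd (fun k => k.natAbs.choose 2) (fun N => ?_)
      (X_pow_dvd_thetaTerm a b hp0)
    refine (Set.finite_Icc (-(N + 1) : ℤ) (N + 1)).subset fun k hk => ?_
    have h1 := le_choose_two_add_one k.natAbs
    rw [Set.mem_ofPred_eq] at hk
    rw [Set.mem_Icc]
    omega
  have h1 : Tendsto (fun N : ℕ => ∑ k ∈ Finset.Icc (-N : ℤ) N, thetaTerm a b p k) atTop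
      (𝓝 (∑' k, thetaTerm a b p k)) :=
    hs.hasSum.comp (Finset.tendsto_Icc_neg_atTop_atTop.comp tendsto_natCast_atTop_atTop)
  have h2 := (tendsto_qPoch p hp0).mul ((tendsto_qPoch a hp0).mul (tendsto_qPoch b hp0))
  have h3 : Tendsto (fun N : ℕ => qPoch p p N * (qPoch a p N * qPoch b p N) -
      ∑ k ∈ Finset.Icc (-N : ℤ) N, thetaTerm a b p k) atTop (𝓝 0) := by
    refine tendsto_of_X_pow_dvd_sub fun N => ?_
    rw [sub_zero, qPoch_mul_qPoch_eq_sum hab hp, Finset.mul_sum, ← Finset.sum_sub_distrib]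
    refine Finset.dvd_sum fun k hk => ?_
    rw [Finset.mem_Icc] at hk
    have h4 := X_pow_dvd_qPoch_mul_gaussBinom_sub_one hp0 (N := N) (m := N - k.natAbs)
      (k := (k + N).toNat) (l := (N - k).toNat) (by omega) (by omega) (by omega) (by omega)
    have h5 := mul_dvd_mul h4 (X_pow_dvd_thetaTerm a b hp0 k)
    rw [← pow_add] at h5
    have h6 := le_choose_two_add_one k.natAbs
    have h7 : N ≤ N - k.natAbs + 1 + k.natAbs.choose 2 := by omega
    rw [← mul_assoc, ← sub_one_mul]
    exact (pow_dvd_pow _ h7).trans h5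
  have h7 := tendsto_nhds_unique (h2.sub h1) h3
  rw [E, sub_eq_zero.mp h7]
  exact hs.hasSum

/-- The signed monomial `(-1)^k z^i q^e`. -/
@[irreducible]
noncomputable def signedMonomial (k i e : ℤ) : Series :=
  ((k.negOnePow : ℤ) : Series) * zpow i * q ^ e.toNat

theorem signedMonomial_mul (k i k' i' : ℤ) {e e' : ℤ} (he : 0 ≤ e) (he' : 0 ≤ e') :
    signedMonomial k i e * signedMonomial k' i' e' =
      signedMonomial (k + k') (i + i') (e + e') := by
  rw [signedMonomial, signedMonomial, signedMonomial, Int.toNat_add he he', pow_add,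
    ← zpow_mul_zpow, Int.negOnePow_add, Units.val_mul, Int.cast_mul]
  ring

theorem signedMonomial_add_one (k i e : ℤ) :
    signedMonomial (k + 1) i e = -signedMonomial k i e := by
  simp [signedMonomial, Int.negOnePow_succ]

theorem signedMonomial_congr {k k' i i' e e' : ℤ} (h : Even (k - k')) (hi : i = i')
    (he : e = e') : signedMonomial k i e = signedMonomial k' i' e' := by
  rw [signedMonomial, signedMonomial, (Int.negOnePow_eq_iff k k').mpr h, hi, he]

theorem int_mul_sub_one_nonneg (m : ℤ) : 0 ≤ m * (m - 1) := by
  rcases le_or_gt m 0 with h | h <;> nlinarith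

theorem abs_sub_one_le_mul_sub_one (m : ℤ) : |m| - 1 ≤ m * (m - 1) := by
  rcases abs_cases m with ⟨h, h'⟩ | ⟨h, h'⟩ <;> rw [h] <;> nlinarith [sq_nonneg (m - 1)]

theorem abs_le_sq (m : ℤ) : |m| ≤ m * m := by
  rcases abs_cases m with ⟨h, h'⟩ | ⟨h, h'⟩ <;> rw [h] <;> nlinarith [int_mul_sub_one_nonneg m]

theorem summable_signedMonomial (s i e : ℤ × ℤ → ℤ) (he : ∀ x, |x.1| + |x.2| ≤ e x + 1) :
    Summable fun x => signedMonomial (s x) (i x) (e x) := by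
  refine summable_of_X_pow_dvd (fun x => (e x).toNat) (fun N => ?_) fun x => by
    rw [signedMonomial]
    exact ⟨_, mul_comm _ _⟩
  refine ((Set.finite_Icc (-(N + 1) : ℤ) (N + 1)).prod
    (Set.finite_Icc (-(N + 1) : ℤ) (N + 1))).subset fun x hx => ?_
  have h := he x
  have h1 := abs_nonneg x.1
  have h2 := abs_nonneg x.2
  rw [Set.mem_ofPred_eq] at hx
  have h3 : |x.1| ≤ N + 1 := by omega
  have h4 : |x.2| ≤ N + 1 := by omega
  exact ⟨abs_le.mp h3, abs_le.mp h4⟩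

theorem q_ne_zero : q ≠ 0 := PowerSeries.X_ne_zero

theorem two_mul_natCast_choose_two (n : ℕ) : 2 * (n.choose 2 : ℤ) = n * (n - 1) := by
  have h : (n : ℤ) * n = n.choose 2 + n.choose 2 + n := mod_cast mul_self_eq_choose_two n
  linear_combination -h

theorem thetaTerm_signed (σ i : ℤ) (j l : ℕ) (k : ℤ) {e : ℤ}
    (he : 2 * e = (j + l) * (k * (k - 1)) + 2 * j * k) :
    thetaTerm ((σ.negOnePow : ℤ) * (zpow i * q ^ j)) ((σ.negOnePow : ℤ) * (zpow (-i) * q ^ l))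
      (q ^ (j + l)) k = signedMonomial (k * (σ + 1)) (i * k) e := by
  have hsign : ((-1 : Series)) ^ k.natAbs * ((σ.negOnePow : ℤ) : Series) ^ k.natAbs =
      (((k * (σ + 1)).negOnePow : ℤ) : Series) := by
    have h1 : (k * (σ + 1)).negOnePow = ((k.natAbs : ℤ) * (σ + 1)).negOnePow := by
      rw [Int.negOnePow_eq_iff]
      rcases Int.natAbs_eq k with h | h <;> rw [h]
      · simp
      · simp only [Int.natAbs_neg, Int.natAbs_natCast]
        exact ⟨-(k.natAbs * (σ + 1)), by ring⟩
    have h2 : ∀ n : ℕ, ((n : ℤ) * (σ + 1)).negOnePow = (-1) ^ n * σ.negOnePow ^ n := by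
      intro n
      induction n with
      | zero => simp
      | succ n ih =>
        rw [Nat.cast_succ, add_one_mul, Int.negOnePow_add, ih, Int.negOnePow_succ, pow_succ,
          pow_succ]
        simp [mul_assoc]
    rw [h1, h2]
    push_cast
    rfl
  have hexp : ∀ n m : ℕ, (n.choose 2 * (j + l) + m : ℤ) = e →
      ((q ^ (j + l)) ^ n.choose 2 * q ^ m : Series) = q ^ e.toNat := by
    intro n m h
    rw [← pow_mul, ← pow_add, ← h]
    congr 1
    zify
    rw [Int.toNat_of_nonneg (by positivity)]
    ring
  rw [thetaTerm, signedMonomial, ← hsign]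
  have hc := two_mul_natCast_choose_two k.natAbs
  split_ifs with hk
  · have hn : (k.natAbs : ℤ) = k := Int.natAbs_of_nonneg hk
    rw [hn] at hc
    rw [mul_pow, mul_pow, zpow_pow, ← pow_mul, hn, mul_comm k i, ← hexp k.natAbs (j * k.natAbs)]
    · ring
    · rw [Nat.cast_mul, hn]
      have : 2 * (k.natAbs.choose 2 * (j + l) + j * k : ℤ) = 2 * e := by
        linear_combination (j + l : ℤ) * hc - he
      exact mul_left_cancel₀ two_ne_zero this
  · have hn : (k.natAbs : ℤ) = -k := by omega
    rw [hn] at hc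
    rw [mul_pow, mul_pow, zpow_pow, ← pow_mul, hn, neg_mul_neg, mul_comm k i,
      ← hexp k.natAbs (l * k.natAbs)]
    · ring
    · rw [Nat.cast_mul, hn]
      have : 2 * (k.natAbs.choose 2 * (j + l) + l * -k : ℤ) = 2 * e := by
        linear_combination (j + l : ℤ) * hc - he
      exact mul_left_cancel₀ two_ne_zero this

theorem hasSum_signedMonomial (σ i : ℤ) {j l : ℕ} (hjl : j + l ≠ 0) (e : ℤ → ℤ)
    (he : ∀ k, 2 * e k = (j + l) * (k * (k - 1)) + 2 * j * k) :
    HasSum (fun k => signedMonomial (k * (σ + 1)) (i * k) (e k))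
      (E (q ^ (j + l)) * (qPochInf ((σ.negOnePow : ℤ) * (zpow i * q ^ j)) (q ^ (j + l)) *
        qPochInf ((σ.negOnePow : ℤ) * (zpow (-i) * q ^ l)) (q ^ (j + l)))) := by
  have h1 : ((σ.negOnePow : ℤ) : Series) * (σ.negOnePow : ℤ) = 1 := by
    rw [← Int.cast_mul, ← Units.val_mul, ← Int.negOnePow_add,
      Int.negOnePow_even _ (Even.add_self σ)]
    simp
  have h2 : zpow i * zpow (-i) = 1 := by rw [zpow_mul_zpow, add_neg_cancel, zpow_zero]
  have h := hasSum_thetaTerm (a := (σ.negOnePow : ℤ) * (zpow i * q ^ j))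
    (b := (σ.negOnePow : ℤ) * (zpow (-i) * q ^ l)) (p := q ^ (j + l))
    (by
      rw [pow_add]
      linear_combination (q ^ j * q ^ l) * zpow i * zpow (-i) * h1 + (q ^ j * q ^ l) * h2)
    (pow_ne_zero _ q_ne_zero) (constantCoeff_q_pow hjl)
  exact h.congr_fun fun k => (thetaTerm_signed σ i j l k (he k)).symm

/-- The theta product `E(q^(j+l)) (z^i q^j; q^(j+l))_∞ (z^(-i) q^l; q^(j+l))_∞`. -/
noncomputable def thetaProd (i : ℤ) (j l : ℕ) : Series :=
  E (q ^ (j + l)) * (qPochInf (zpow i * q ^ j) (q ^ (j + l)) *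
    qPochInf (zpow (-i) * q ^ l) (q ^ (j + l)))

theorem hasSum_thetaProd (i : ℤ) {j l : ℕ} (hjl : j + l ≠ 0) (e : ℤ → ℤ)
    (he : ∀ k, 2 * e k = (j + l) * (k * (k - 1)) + 2 * j * k) :
    HasSum (fun k => signedMonomial k (i * k) (e k)) (thetaProd i j l) := by
  simpa [thetaProd] using hasSum_signedMonomial 0 i hjl e he

theorem E_q_pow_four : E (q ^ 4) = thetaProd 0 8 4 := by
  have h4 : PowerSeries.constantCoeff (q ^ 4) = 0 := constantCoeff_q_pow (by norm_num)
  rw [thetaProd, E, qPochInf_eq_prod (q ^ 4) h4 (m := 3) (by norm_num)]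
  simp only [Finset.prod_range_succ, Finset.prod_range_zero, neg_zero, zpow_zero, E]
  ring_nf

theorem thetaProd_zero_comm (j l : ℕ) : thetaProd 0 j l = thetaProd 0 l j := by
  simp only [thetaProd, neg_zero, add_comm l j, mul_comm (qPochInf (zpow 0 * q ^ l) _)]

/-- Sorting the pairs `(m, n)` by the residue of `m + 2 * n` modulo three. -/
theorem bijective_residue_split : Function.Bijective
    (Sum.elim (fun x : ℤ × ℤ => (x.1 - 2 * x.2, x.1 + x.2))
      (Sum.elim (fun x : ℤ × ℤ => (x.1 - 2 * x.2 + 1, x.1 + x.2))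
        (fun x : ℤ × ℤ => (x.1 - 2 * x.2 + 2, x.1 + x.2)))) := by
  constructor
  · rintro (⟨k, l⟩ | ⟨k, l⟩ | ⟨k, l⟩) (⟨k', l'⟩ | ⟨k', l'⟩ | ⟨k', l'⟩) h <;>
      simp only [Sum.elim_inl, Sum.elim_inr, Prod.mk.injEq] at h <;>
      simp only [Sum.inl.injEq, Sum.inr.injEq, Prod.mk.injEq, reduceCtorEq] <;> omega
  · rintro ⟨m, n⟩
    have h : (m + 2 * n) % 3 = 0 ∨ (m + 2 * n) % 3 = 1 ∨ (m + 2 * n) % 3 = 2 := by omega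
    rcases h with h | h | h
    · refine ⟨Sum.inl ((m + 2 * n) / 3, n - (m + 2 * n) / 3), ?_⟩
      simp only [Sum.elim_inl, Prod.mk.injEq]
      omega
    · refine ⟨Sum.inr (Sum.inl ((m + 2 * n) / 3, n - (m + 2 * n) / 3)), ?_⟩
      simp only [Sum.elim_inl, Sum.elim_inr, Prod.mk.injEq]
      omega
    · refine ⟨Sum.inr (Sum.inr ((m + 2 * n) / 3, n - (m + 2 * n) / 3)), ?_⟩
      simp only [Sum.elim_inr, Prod.mk.injEq]
      omega

theorem hasSum_mul_signedMonomial {s s' i i' e e' : ℤ → ℤ} {F G : Series}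
    (hF : HasSum (fun k => signedMonomial (s k) (i k) (e k)) F)
    (hG : HasSum (fun k => signedMonomial (s' k) (i' k) (e' k)) G)
    (he : ∀ k, 0 ≤ e k) (he' : ∀ k, 0 ≤ e' k) (h : ∀ k l, |k| + |l| ≤ e k + e' l + 1) :
    HasSum (fun x : ℤ × ℤ => signedMonomial (s x.1 + s' x.2) (i x.1 + i' x.2) (e x.1 + e' x.2))
      (F * G) := by
  have h1 := summable_signedMonomial (fun x => s x.1 + s' x.2) (fun x => i x.1 + i' x.2)
    (fun x => e x.1 + e' x.2) fun x => h x.1 x.2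
  have h2 := hF.mul hG (h1.congr fun x =>
    (signedMonomial_mul _ _ _ _ (he x.1) (he' x.2)).symm)
  exact h2.congr_fun fun x => (signedMonomial_mul _ _ _ _ (he x.1) (he' x.2)).symm

theorem eq_zero_of_eq_neg {F : Series} (h : F = -F) : F = 0 := by
  refine PowerSeries.ext fun n => LaurentPolynomial.ext fun m => ?_
  have h1 := congrArg (fun G : Series => (PowerSeries.coeff n G).coeff m) h
  simp only [map_neg, AddMonoidAlgebra.coeff_neg, Finsupp.neg_apply] at h1
  simp only [map_zero, AddMonoidAlgebra.coeff_zero, Finsupp.zero_apply]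
  omega

theorem hasSum_eq_zero_of_antisymmetric :
    HasSum (fun x : ℤ × ℤ => signedMonomial (x.1 + x.2) (6 * x.1 + 4)
      (3 * (x.1 * x.1) + 3 * x.1 + 6 * (x.2 * (x.2 - 1)) + 2)) 0 := by
  have hs := summable_signedMonomial (fun x => x.1 + x.2) (fun x => 6 * x.1 + 4)
    (fun x => 3 * (x.1 * x.1) + 3 * x.1 + 6 * (x.2 * (x.2 - 1)) + 2) fun x => by
      have h1 := abs_sub_one_le_mul_sub_one x.2
      have h2 := abs_sub_one_le_mul_sub_one (-x.1)
      rw [abs_neg] at h2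
      have h3 := int_mul_sub_one_nonneg x.2
      have h4 := int_mul_sub_one_nonneg (-x.1)
      linarith
  have h1 := hs.hasSum
  have h2 := ((Equiv.prodCongr (Equiv.refl ℤ) (Equiv.subLeft (1 : ℤ))).hasSum_iff.mpr h1)
  have h3 := h2.unique (h1.neg.congr_fun fun x => ?_)
  · rwa [eq_zero_of_eq_neg h3] at h1
  · rw [← signedMonomial_add_one]
    refine signedMonomial_congr ⟨-x.2, ?_⟩ rfl ?_ <;>
    · simp only [Equiv.prodCongr_apply, Prod.map_fst, Prod.map_snd, Equiv.refl_apply,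
        Equiv.subLeft_apply]
      ring

/-- The quintuple product identity. -/
theorem quintuple_product :
    E (q ^ 2) * (qPochInf (-zpow 2) (q ^ 2) * qPochInf (-(zpow (-2) * q ^ 2)) (q ^ 2)) *
      (qPochInf (zpow 4 * q ^ 2) (q ^ 4) * qPochInf (zpow (-4) * q ^ 2) (q ^ 4)) =
    thetaProd 6 2 4 + zpow 2 * thetaProd 6 4 2 := by
  have hE : E (q ^ 4) ≠ 0 := E_ne_zero (constantCoeff_q_pow (by norm_num))
  have hA := hasSum_signedMonomial 1 2 (j := 0) (l := 2) (by norm_num) (fun m => m * (m - 1))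
    fun k => by push_cast; ring
  have hB := hasSum_thetaProd 4 (j := 2) (l := 2) (by norm_num) (fun n => 2 * (n * n))
    fun k => by push_cast; ring
  have hAB := hasSum_mul_signedMonomial hA hB int_mul_sub_one_nonneg
    (fun k => by linarith [mul_self_nonneg k]) fun k l => by
      linarith [abs_sub_one_le_mul_sub_one k, abs_le_sq l, mul_self_nonneg l]
  have hC := hasSum_thetaProd 6 (j := 2) (l := 4) (by norm_num) (fun k => 3 * (k * k) - k)
    fun k => by push_cast; ring
  have hD := hasSum_thetaProd 6 (j := 4) (l := 2) (by norm_num) (fun k => 3 * (k * k) + k)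
    fun k => by push_cast; ring
  have hE1 := hasSum_thetaProd 0 (j := 8) (l := 4) (by norm_num) (fun l => 6 * (l * l) + 2 * l)
    fun k => by push_cast; ring
  have hE2 := hasSum_thetaProd 0 (j := 4) (l := 8) (by norm_num) (fun l => 6 * (l * l) - 2 * l)
    fun k => by push_cast; ring
  have hn : ∀ k : ℤ, 0 ≤ 3 * (k * k) - k := fun k => by
    linarith [abs_le_sq k, le_abs_self k, mul_self_nonneg k]
  have hn' : ∀ k : ℤ, 0 ≤ 3 * (k * k) + k := fun k => by
    linarith [abs_le_sq k, neg_abs_le k, mul_self_nonneg k]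
  have h1 := hasSum_mul_signedMonomial hC hE1 hn (fun k => by linarith [hn' k]) fun k l => by
    linarith [abs_le_sq k, abs_le_sq l, le_abs_self k, neg_abs_le l, mul_self_nonneg k,
      mul_self_nonneg l]
  have h2 := (hasSum_mul_signedMonomial hD hE2 hn' (fun k => by linarith [hn k]) fun k l => by
    linarith [abs_le_sq k, abs_le_sq l, neg_abs_le k, le_abs_self l, mul_self_nonneg k,
      mul_self_nonneg l]).mul_left (zpow 2)
  have h3 := h1.sum (h2.sum hasSum_eq_zero_of_antisymmetric) (f := Sum.elim _ (Sum.elim _ _))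
  have h4 := h3.unique (((Equiv.ofBijective _ bijective_residue_split).hasSum_iff.mpr
    hAB).congr_fun ?_)
  · apply mul_left_cancel₀ hE
    rw [thetaProd_zero_comm 4 8, ← E_q_pow_four, add_zero] at h4
    have h22 : thetaProd 4 2 2 = E (q ^ 4) * (qPochInf (zpow 4 * q ^ 2) (q ^ 4) *
      qPochInf (zpow (-4) * q ^ 2) (q ^ 4)) := rfl
    rw [h22] at h4
    simp only [Int.negOnePow_one, Units.val_neg, Units.val_one, Int.cast_neg, Int.cast_one,
      neg_one_mul, pow_zero, mul_one, zero_add] at h4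
    linear_combination -h4
  · rintro (⟨k, l⟩ | ⟨k, l⟩ | ⟨k, l⟩)
    · simp only [Function.comp_apply, Equiv.ofBijective_apply, Sum.elim_inl]
      exact signedMonomial_congr ⟨2 * l - k, by ring⟩ (by ring) (by ring)
    · simp only [Function.comp_apply, Equiv.ofBijective_apply, Sum.elim_inl, Sum.elim_inr]
      have h5 : zpow 2 = signedMonomial 0 2 0 := by simp [signedMonomial]
      rw [h5, signedMonomial_mul _ _ _ _ le_rfl (by linarith [hn' k, hn l])]
      exact signedMonomial_congr ⟨2 * l - k - 1, by ring⟩ (by ring) (by ring)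
    · simp only [Function.comp_apply, Equiv.ofBijective_apply, Sum.elim_inr]
      exact signedMonomial_congr ⟨2 * l - k - 2, by ring⟩ (by ring) (by ring)

theorem quotientNonneg_of_exists {num den : Series} (hden : den ≠ 0)
    (h : ∃ F, Nonneg F ∧ F * den = num) : QuotientNonneg num den := by
  obtain ⟨F, hF, hFd⟩ := h
  have huniq : ∀ G, G * den = num → G = F := fun G hG =>
    mul_right_cancel₀ hden (hG.trans hFd.symm)
  exact ⟨⟨F, hFd, huniq⟩, fun G hG => huniq G hG ▸ hF⟩

theorem constantCoeff_mul_q_pow (F : Series) {n : ℕ} (hn : n ≠ 0) :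
    PowerSeries.constantCoeff (F * q ^ n) = 0 := by
  rw [map_mul, constantCoeff_q_pow hn, mul_zero]

theorem constantCoeff_zpow (i : ℤ) :
    PowerSeries.constantCoeff (zpow i) = LaurentPolynomial.T i := by
  simp [zpow]

theorem T_ne_one {i : ℤ} (hi : i ≠ 0) : (LaurentPolynomial.T i : LaurentPolynomial ℤ) ≠ 1 := by
  intro h
  have h1 := congrArg (fun f => f.coeff 0) h
  rw [← LaurentPolynomial.T_zero] at h1
  simp [hi] at h1

theorem zpow_mul_neg (i : ℤ) : zpow i * zpow (-i) = 1 := by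
  rw [zpow_mul_zpow, add_neg_cancel, zpow_zero]

theorem qPochInf_zpow_ne_zero {i : ℤ} (hi : i ≠ 0) {n : ℕ} (hn : n ≠ 0) :
    qPochInf (zpow i) (q ^ n) ≠ 0 :=
  qPochInf_ne_zero (constantCoeff_q_pow hn) (by rw [constantCoeff_zpow]; exact T_ne_one hi)

theorem qPochInf_mul_q_pow_ne_zero (F : Series) {m n : ℕ} (hm : m ≠ 0) (hn : n ≠ 0) :
    qPochInf (F * q ^ m) (q ^ n) ≠ 0 :=
  qPochInf_ne_zero (constantCoeff_q_pow hn) (by rw [constantCoeff_mul_q_pow F hm]; simp)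

theorem qPochInf_eq_mul_mul (a : Series) {n : ℕ} (hn : n ≠ 0) :
    qPochInf a (q ^ n) = qPochInf a (q ^ (n * 3)) *
      qPochInf (a * q ^ n) (q ^ (n * 3)) * qPochInf (a * q ^ (n * 2)) (q ^ (n * 3)) := by
  rw [qPochInf_eq_prod a (constantCoeff_q_pow hn) (m := 3) (by norm_num), ← pow_mul]
  simp [Finset.prod_range_succ, ← pow_mul]

/-- `E(q^6) (y²q²;q⁶)_∞ (y⁻²q⁴;q⁶)_∞ / ((yq;q²)_∞ (y⁻¹q;q²)_∞) ⪰ 0` for `y = z^i`. -/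
theorem exists_nonneg_mul_eq_thetaProd (i : ℤ) : ∃ H, Nonneg H ∧
    H * (qPochInf (zpow i * q) (q ^ 2) * qPochInf (zpow (-i) * q) (q ^ 2)) =
      thetaProd (2 * i) 2 4 := by
  have hP : PowerSeries.constantCoeff (q ^ 6) = 0 := constantCoeff_q_pow (by norm_num)
  have hP' : Nonneg (q ^ 6) := nonneg_q.pow 6
  have hc : ∀ (j : ℤ) (n : ℕ), PowerSeries.constantCoeff (zpow j * q ^ (n + 1)) = 0 :=
    fun j n => constantCoeff_mul_q_pow _ n.succ_ne_zero
  have hn := nonneg_zpow_mul_q_pow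
  obtain ⟨G, hG, hGe⟩ := exists_nonneg_mul_eq_qPochInf_mul hP (hc i 2) (hc i 4) hP' (hn i 3)
    (hn i 5)
  obtain ⟨G', hG', hGe'⟩ := exists_nonneg_mul_eq_qPochInf_mul hP (hc (-i) 0) (hc (-i) 2) hP'
    (hn (-i) 1) (hn (-i) 3)
  obtain ⟨K, hK, hKe⟩ := exists_nonneg_mul_eq_one_add_mul_E (b := zpow (-i) * q ^ 5)
    (c := zpow i * q ^ 1) hP (hc (-i) 4) hP' (hn (-i) 5) (hn i 1)
    (by linear_combination q ^ 6 * zpow_mul_neg i)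
  refine ⟨K * G * G', (hK.mul hG).mul hG', ?_⟩
  have h2 : zpow (2 * i) = zpow i * zpow i := by rw [zpow_mul_zpow, two_mul]
  have h2' : zpow (-(2 * i)) = zpow (-i) * zpow (-i) := by
    rw [zpow_mul_zpow, two_mul, neg_add]
  have e1 := qPochInf_eq_mul_mul (zpow i * q) (n := 2) (by norm_num)
  have e2 := qPochInf_eq_mul_mul (zpow (-i) * q) (n := 2) (by norm_num)
  have e3 := qPochInf_eq_one_sub_mul (zpow i * q) hP
  have e4 := qPochInf_eq_one_sub_mul (zpow (2 * i) * q ^ 2) hP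
  rw [e3] at e1
  rw [e1, e2, thetaProd, e4, h2, h2']
  have a1 : zpow i * q * q ^ 2 = zpow i * q ^ 3 := by ring
  have a2 : zpow i * q * q ^ (2 * 2) = zpow i * q ^ 5 := by ring
  have a3 : zpow (-i) * q * q ^ 2 = zpow (-i) * q ^ 3 := by ring
  have a4 : zpow (-i) * q * q ^ (2 * 2) = zpow (-i) * q ^ 5 := by ring
  have a5 : zpow i * q ^ 3 * (zpow i * q ^ 5) = zpow i * zpow i * q ^ 2 * q ^ 6 := by ring
  have a6 : zpow (-i) * q ^ 1 * (zpow (-i) * q ^ 3) = zpow (-i) * zpow (-i) * q ^ 4 := by ring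
  rw [a5] at hGe
  rw [a6] at hGe'
  rw [pow_one] at hGe' hKe
  rw [a1, a2, a3, a4]
  norm_num only
  rw [← hGe, ← hGe']
  linear_combination (1 - zpow i * q) * G * G' * qPochInf (zpow i * q ^ 3) (q ^ 6) *
    qPochInf (zpow i * q ^ 5) (q ^ 6) * qPochInf (zpow (-i) * q) (q ^ 6) *
    qPochInf (zpow (-i) * q ^ 3) (q ^ 6) * hKe

theorem thetaProd_neg (i : ℤ) (j l : ℕ) : thetaProd (-i) j l = thetaProd i l j := by
  rw [thetaProd, thetaProd, neg_neg, add_comm l j,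
    mul_comm (qPochInf (zpow (-i) * q ^ j) _)]

theorem E_mul_bracket_four :
    E (q ^ 2) * bracket 4 0 2 = bracket 2 0 2 * (thetaProd 6 2 4 + zpow 2 * thetaProd 6 4 2) := by
  have h2 : PowerSeries.constantCoeff (q ^ 2) = 0 := constantCoeff_q_pow (by norm_num)
  have e1 := qPochInf_eq_prod (zpow 4) h2 (m := 2) (by norm_num)
  have e2 := qPochInf_eq_prod (zpow (-4) * q ^ 2) h2 (m := 2) (by norm_num)
  have e3 := qPochInf_sq (zpow 2) h2
  have e4 := qPochInf_sq (zpow (-2) * q ^ 2) h2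
  have a1 : zpow 2 ^ 2 = zpow 4 := zpow_pow 2 2
  have a2 : (zpow (-2) * q ^ 2) ^ 2 = zpow (-4) * q ^ 4 := by
    rw [mul_pow, zpow_pow, ← pow_mul]; norm_num
  have a3 : (q ^ 2) ^ 2 = q ^ 4 := by ring
  have a4 : zpow (-4) * q ^ 2 * q ^ 2 = zpow (-4) * q ^ 4 := by ring
  simp only [Finset.prod_range_succ, Finset.prod_range_zero, pow_zero, pow_one, one_mul,
    mul_one, a3, a4] at e1 e2
  rw [a1, a3] at e3
  rw [a2, a3] at e4
  rw [← quintuple_product]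
  simp only [bracket, pow_zero, mul_one, Nat.sub_zero]
  rw [e1, e2, e3, e4]
  ring

theorem quotientNonneg_bracket :
    QuotientNonneg (E (q ^ 2) * bracket 4 0 2) (bracket 2 0 2 * bracket 3 1 2) := by
  apply quotientNonneg_of_exists
  · refine mul_ne_zero (mul_ne_zero ?_ ?_) (mul_ne_zero ?_ ?_)
    · simpa using qPochInf_zpow_ne_zero (i := 2) (n := 2) (by norm_num) (by norm_num)
    all_goals exact qPochInf_mul_q_pow_ne_zero _ (by norm_num) (by norm_num)
  obtain ⟨H, hH, hHe⟩ := exists_nonneg_mul_eq_thetaProd 3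
  obtain ⟨H', hH', hHe'⟩ := exists_nonneg_mul_eq_thetaProd (-3)
  refine ⟨H + zpow 2 * H', hH.add ((nonneg_zpow 2).mul hH'), ?_⟩
  have h1 : thetaProd (2 * -3) 2 4 = thetaProd 6 4 2 := thetaProd_neg 6 2 4
  have h2 : bracket 3 1 2 =
      qPochInf (zpow 3 * q) (q ^ 2) * qPochInf (zpow (-3) * q) (q ^ 2) := by
    simp [bracket]
  rw [neg_neg, h1] at hHe'
  have h3 : thetaProd (2 * 3) 2 4 = thetaProd 6 2 4 := rfl
  rw [h3] at hHe
  rw [E_mul_bracket_four, h2]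
  linear_combination bracket 2 0 2 * hHe + bracket 2 0 2 * zpow 2 * hHe'

theorem quotientNonneg_cubic :
    QuotientNonneg (E (q ^ 3) * qPochInf (zpow 2) (q ^ 3))
      (qPochInf (zpow (-1) * q ^ 3) (q ^ 3) * qPochInf (zpow 1) q) := by
  have h3 : PowerSeries.constantCoeff (q ^ 3) = 0 := constantCoeff_q_pow (by norm_num)
  have h3' : Nonneg (q ^ 3) := nonneg_q.pow 3
  apply quotientNonneg_of_exists
  · refine mul_ne_zero (qPochInf_mul_q_pow_ne_zero _ (by norm_num) (by norm_num)) ?_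
    simpa using qPochInf_zpow_ne_zero (i := 1) (n := 1) (by norm_num) (by norm_num)
  obtain ⟨G, hG, hGe⟩ := exists_nonneg_mul_eq_qPochInf_mul h3
    (constantCoeff_mul_q_pow (zpow 1) one_ne_zero)
    (constantCoeff_mul_q_pow (zpow 1) two_ne_zero) h3' (nonneg_zpow_mul_q_pow 1 1)
    (nonneg_zpow_mul_q_pow 1 2)
  obtain ⟨K, hK, hKe⟩ := exists_nonneg_mul_eq_one_add_mul_E (b := zpow (-1) * q ^ 3)
    (c := zpow 1) h3 (constantCoeff_mul_q_pow _ three_ne_zero) h3' (nonneg_zpow_mul_q_pow (-1) 3)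
    (nonneg_zpow 1) (by linear_combination q ^ 3 * zpow_mul_neg 1)
  refine ⟨K * G, hK.mul hG, ?_⟩
  have e1 := qPochInf_eq_mul_mul (zpow 1) (n := 1) (by norm_num)
  have e2 := qPochInf_eq_one_sub_mul (zpow 1) h3
  have e3 := qPochInf_eq_one_sub_mul (zpow 2) h3
  have a1 : zpow 2 = zpow 1 * zpow 1 := (zpow_mul_zpow 1 1).symm
  have a2 : zpow 1 * q ^ 1 * (zpow 1 * q ^ 2) = zpow 1 * zpow 1 * q ^ 3 := by ring
  norm_num only at e1
  rw [e2] at e1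
  rw [a2] at hGe
  rw [pow_one] at hGe e1
  rw [e1, e3, a1, ← hGe]
  linear_combination (1 - zpow 1) * G * qPochInf (zpow 1 * q) (q ^ 3) *
    qPochInf (zpow 1 * q ^ 2) (q ^ 3) * hKe

end QProducts

theorem mainTheorem9 :
    QProducts.QuotientNonneg
      (QProducts.E (QProducts.q ^ 2) * QProducts.bracket 4 0 2)
      (QProducts.bracket 2 0 2 * QProducts.bracket 3 1 2) ∧
    QProducts.QuotientNonneg
      (QProducts.E (QProducts.q ^ 3) * QProducts.qPochInf (QProducts.zpow 2) (QProducts.q ^ 3))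
      (QProducts.qPochInf (QProducts.zpow (-1) * QProducts.q ^ 3) (QProducts.q ^ 3) *
        QProducts.qPochInf (QProducts.zpow 1) QProducts.q) := by
  exact ⟨QProducts.quotientNonneg_bracket, QProducts.quotientNonneg_cubic⟩
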